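/- Let $\mathcal X$ be a set, $n,m\ge 1$, $\widetilde D\in\mathcal X^n$ (private dataset) and $\widehat D\in\mathcal X^m$ (public dataset), and let $\widehat{\mathcal X}=\mathrm{supp}(\widehat D)$ be the set of records occurring in $\widehat D$. Let $\mathcal Q$ be a nonempty finite set of queries $q:\mathcal X\to[0,1]$; write $q(D)=\frac1n\sum_{i} q(D_i)$ for a dataset $D\in\mathcal X^n$ and $q(A)=\sum_{x}A(x)q(x)$ for a distribution $A$ on $\widehat{\mathcal X}$. The best mixture error is $$f_{\widetilde D,\mathcal Q}(\widehat{\mathcal X})=\min_{\mu\in\Delta(\widehat{\mathcal X})}\max_{q\in\mathcal Q}\Big|q(\widetilde D)-\sum_{x\in\widehat{\mathcal X}}\mu_x q(x)\Big| .$$ For $\tilde\varepsilon>0$ and an integer $T\ge1$, the algorithm $\mathsf{PMW}^{\mathsf{Pub}}$ sets $\varepsilon_0=\tilde\varepsilon/\sqrt{2T}$, lets $A_0$ be the empirical distribution of $\widehat D$ on $\widehat{\mathcal X}$, and for $t=1,\dots,T$: 1. selects $q_t\in\mathcal Q$ with scores $s_q=|q(A_{t-1})-q(\widetilde D)|$,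 using either the exponential mechanism, $\Pr[q_t=q]\propto\exp(\frac{\varepsilon_0n}{2}s_q)$, or the permute-and-flip mechanism (visit the queries in uniformly random order, accept $q$ with probability $\exp(\frac{\varepsilon_0 n}{2}(s_q-\max_r s_r))$, and return the first accepted query); 2. sets $a_t$ to be $q_t(\widetilde D)+\mathcal N(0,\frac{1}{n^2\varepsilon_0^2})$, with fresh independent noise, clipped to $[0,1]$; 3. lets $A_t$ be the distribution on $\widehat{\mathcal X}$ with $A_t(x)\propto A_{t-1}(x)\exp\big(q_t(x)(a_t-q_t(A_{t-1}))/2\big)$. The output is $A=\frac1T\sum_{t=1}^{T}A_{t-1}$. Then, for either selection mechanism: **(i)** $A$ is a distribution on $\widehat{\mathcal X}$, and for every $\beta\in(0,1)$ with $T\ge 7\log(3/\beta)$, with probability at least $1-\beta$, $$\max_{q\in\mathcal Q}|q(\widetilde D)-q(A)|\le 2f_{\widetilde D,\mathcal Q}(\widehat{\mathcal X})+\sqrt{\frac{4\log m}{T}+\frac{4T}{\tilde\varepsilon^2n^2}+\frac{4\sqrt{\log(3/\beta)}}{\tilde\varepsilon n}}+\frac{2\sqrt{2T}}{\tilde\varepsilon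 n}\log|\mathcal Q|+\sqrt{\frac1{2T}\log\Big(\frac3\beta\Big)} .$$ **(ii)** For all constants $c_1,c_2>0$ there is a constant $C>0$, depending only on $c_1,c_2$, such that the following holds for all $\mathcal X,n,m,\widetilde D,\widehat D,\mathcal Q,\tilde\varepsilon$ as above with $|\mathcal Q|\ge2$ and all $\beta\in(0,1)$. Put $R=\frac{n\tilde\varepsilon\sqrt{\log m}}{\log|\mathcal Q|}+\log(1/\beta)$. If $T\ge 1$ is an integer with $c_1R\le T\le c_2R+1$ (that is, $T=\Theta(R)$ up to rounding), then with probability at least $1-\beta$, $$\max_{q\in\mathcal Q}|q(A)-q(\widetilde D)|\le C\left(\sqrt{\frac{\log|\mathcal Q|\,\big(\sqrt{\log m}+\log(1/\beta)\big)}{n\tilde\varepsilon}}+f_{\widetilde D,\mathcal Q}(\widehat{\mathcal X})\right).$$ -/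

import Mathlib

open MeasureTheory ProbabilityTheory

universe u

namespace PMWPub

/-- A statistical query `q : X → [0,1]`. -/
def StatQuery (X : Type u) : Type u := X → unitInterval

instance (X : Type u) : CoeFun (StatQuery X) (fun _ => X → unitInterval) := ⟨fun q => q⟩

/-- The discrete σ-algebra: only finite sets of queries are ever sampled from. -/
instance (X : Type u) : MeasurableSpace (StatQuery X) := ⊤

instance (X : Type u) : DiscreteMeasurableSpace (StatQuery X) := ⟨fun _ => trivial⟩

section Basic

variable {X : Type u} {n m : ℕ}

/-- The value `q(D) = (1/n) ∑ᵢ q(Dᵢ)` of a query on a dataset of `n` records. -/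
noncomputable def evalData (q : StatQuery X) (D : Fin n → X) : ℝ :=
  (∑ i, (q (D i) : ℝ)) / n

/-- The value `q(A) = ∑ₓ A(x) q(x)` of a query on a weighting of a finite set `S`. -/
noncomputable def evalDist {S : Finset X} (q : StatQuery X) (A : S → ℝ) : ℝ :=
  ∑ x : S, A x * (q x : ℝ)

/-- `max_{q ∈ Q} |q(A) - q(D)|`. -/
noncomputable def maxError {S : Finset X} (Q : Finset (StatQuery X)) (D : Fin n → X)
    (A : S → ℝ) : ℝ :=
  ⨆ q : Q, |evalDist q.1 A - evalData q.1 D|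

/-- The best mixture error `f_{D,Q}(S) = min_{μ ∈ Δ(S)} max_{q ∈ Q} |q(D) - ∑_{x ∈ S} μₓ q(x)|`. -/
noncomputable def bestMixtureError (D : Fin n → X) (Q : Finset (StatQuery X))
    (S : Finset X) : ℝ :=
  ⨅ μ : stdSimplex ℝ S, maxError Q D (μ : S → ℝ)

/-- The set of records that occur in a dataset. -/
def supp [DecidableEq X] (D : Fin m → X) : Finset X := Finset.univ.image D

/-- The empirical distribution of a dataset, on its support. -/
noncomputable def empirical [DecidableEq X] (D : Fin m → X) : supp D → ℝ :=
  fun x => ((Finset.univ.filter (fun i => D i = x)).card : ℝ) / m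

end Basic

section Selection

variable {ι : Type u} [Fintype ι]

/-- The two mechanisms that may be used to select a query. -/
inductive Selection : Type
  | exponential
  | permuteAndFlip

/-- Exponential mechanism: `i` is returned with probability proportional to `exp (c * s i)`. -/
noncomputable def expProb (c : ℝ) (s : ι → ℝ) (i : ι) : ℝ :=
  Real.exp (c * s i) / ∑ j, Real.exp (c * s j)

/-- The acceptance probability of `i` in the permute-and-flip mechanism. -/
noncomputable def flipProb (c : ℝ) (s : ι → ℝ) (i : ι) : ℝ :=
  Real.exp (c * (s i - ⨆ j, s j))

open Classical in
/-- Permute-and-flip mechanism: visit the candidates in a uniformly random order (`σ j` is the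
position of `j`), at each of them flip a coin with success probability `flipProb c s j`, and
return the first one whose coin succeeds. This is the probability that `i` is returned. -/
noncomputable def permuteFlipProb (c : ℝ) (s : ι → ℝ) (i : ι) : ℝ :=
  (∑ σ : ι ≃ Fin (Fintype.card ι),
      flipProb c s i * ∏ j ∈ Finset.univ.filter (fun j => σ j < σ i), (1 - flipProb c s j)) /
    (Fintype.card ι).factorial

/-- The probability that the chosen mechanism returns `i` on the scores `s`. -/
noncomputable def selectProb : Selection → ℝ → (ι → ℝ) → ι → ℝ
  | .exponential => expProb
  | .permuteAndFlip => permuteFlipProb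

lemma flipProb_le_one {c : ℝ} (hc : 0 ≤ c) (s : ι → ℝ) (i : ι) : flipProb c s i ≤ 1 := by
  rw [flipProb, Real.exp_le_one_iff]
  exact mul_nonpos_of_nonneg_of_nonpos hc
    (sub_nonpos.2 (le_ciSup (Set.finite_range s).bddAbove i))

lemma selectProb_nonneg (M : Selection) {c : ℝ} (hc : 0 ≤ c) (s : ι → ℝ) (i : ι) :
    0 ≤ selectProb M c s i := by
  cases M
  · simp only [selectProb, expProb]; positivity
  · simp only [selectProb, permuteFlipProb]
    refine div_nonneg (Finset.sum_nonneg fun σ _ => mul_nonneg (Real.exp_pos _).le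
      (Finset.prod_nonneg fun j _ => sub_nonneg.2 (flipProb_le_one hc s j))) (by positivity)

lemma sum_permuteFlip_order [Nonempty ι] (c : ℝ) (s : ι → ℝ)
    (σ : ι ≃ Fin (Fintype.card ι)) :
    ∑ i, flipProb c s i * ∏ j ∈ Finset.univ.filter (fun j => σ j < σ i), (1 - flipProb c s j)
      = 1 := by
  classical
  have h := Finset.prod_one_sub_ordered (Finset.univ : Finset (Fin (Fintype.card ι)))
    (fun k => flipProb c s (σ.symm k))
  obtain ⟨i₀, hi₀⟩ := exists_eq_ciSup_of_finite (f := s)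
  have h0 : ∏ k, (1 - flipProb c s (σ.symm k)) = 0 :=
    Finset.prod_eq_zero (Finset.mem_univ (σ i₀)) (by simp [flipProb, hi₀])
  rw [h0] at h
  rw [← Equiv.sum_comp σ.symm]
  have h1 : ∀ k : Fin (Fintype.card ι),
      ∏ j ∈ Finset.univ.filter (fun j => σ j < σ (σ.symm k)), (1 - flipProb c s j)
        = ∏ j ∈ Finset.univ.filter (fun j => j < k), (1 - flipProb c s (σ.symm j)) := by
    intro k
    simp only [Finset.prod_filter, Equiv.apply_symm_apply]
    rw [← Equiv.prod_comp σ.symm]; simp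
  simp only [h1]
  linarith

lemma sum_selectProb [Nonempty ι] (M : Selection) (c : ℝ) (s : ι → ℝ) :
    ∑ i, selectProb M c s i = 1 := by
  classical
  cases M
  · simp only [selectProb, expProb, ← Finset.sum_div]
    exact div_self (Finset.sum_pos (fun i _ => Real.exp_pos _) Finset.univ_nonempty).ne'
  · simp only [selectProb, permuteFlipProb, ← Finset.sum_div]
    rw [Finset.sum_comm, Finset.sum_congr rfl fun σ _ => sum_permuteFlip_order c s σ]
    rw [Finset.sum_const, Finset.card_univ, Fintype.card_equiv (Fintype.equivFin ι)]
    simp [Nat.factorial_ne_zero]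

end Selection

section Algorithm

variable {X : Type u} {n m : ℕ}

/-- The per-round parameter `ε₀ = ε / √(2T)`. -/
noncomputable def roundEps (ε : ℝ) (T : ℕ) : ℝ := ε / Real.sqrt (2 * T)

/-- A noisy answer, clipped to `[0,1]`. -/
noncomputable def noisyAnswer (D : Fin n → X) (q : StatQuery X) (z : ℝ) : ℝ :=
  max 0 (min 1 (evalData q D + z))

/-- The multiplicative weights update of `A` on the query `q` with answer `a`. -/
noncomputable def mwUpdate {S : Finset X} (A : S → ℝ) (q : StatQuery X) (a : ℝ) : S → ℝ :=
  fun x => A x * Real.exp ((q x : ℝ) * (a - evalDist q A) / 2) /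
    ∑ y : S, A y * Real.exp ((q y : ℝ) * (a - evalDist q A) / 2)

/-- The random choices made in `t` rounds: in each round the selected query and the Gaussian noise
(before clipping). Round `i + 1` of the algorithm is stored at index `i`. -/
abbrev Transcript (Q : Finset (StatQuery X)) (t : ℕ) : Type u := Fin t → Q × ℝ

/-- The distribution `A_t` maintained by the algorithm, as a function of the first `t` rounds. -/
noncomputable def iterate [DecidableEq X] (Dpriv : Fin n → X) (Dpub : Fin m → X)
    (Q : Finset (StatQuery X)) :
    (t : ℕ) → Transcript Q t → (supp Dpub → ℝ)
  | 0, _ => empirical Dpub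
  | t + 1, h =>
      mwUpdate (iterate Dpriv Dpub Q t (Fin.init h)) (h (Fin.last t)).1.1
        (noisyAnswer Dpriv (h (Fin.last t)).1.1 (h (Fin.last t)).2)

/-- The output `A = (1/T) ∑_{t=1}^{T} A_{t-1}`. -/
noncomputable def output [DecidableEq X] (Dpriv : Fin n → X) (Dpub : Fin m → X) (Q : Finset (StatQuery X))
    (T : ℕ) (h : Transcript Q T) : supp Dpub → ℝ :=
  fun x => (∑ t : Fin T,
    iterate Dpriv Dpub Q t (fun i => h (Fin.castLE t.2.le i)) x) / T

/-- Probability that `q` is selected when the current distribution is `A`: the scores are the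
errors `|q(A) - q(D)|`, scaled by `ε₀ n / 2`. -/
noncomputable def queryProb (M : Selection) (ε₀ : ℝ) (D : Fin n → X)
    (Q : Finset (StatQuery X)) {S : Finset X} (A : S → ℝ) (q : Q) : ℝ :=
  selectProb M (ε₀ * n / 2) (fun r : Q => |evalDist r.1 A - evalData r.1 D|) q

/-- The noise distribution `N(0, 1/(n² ε₀²))`. -/
noncomputable def noiseLaw (n : ℕ) (ε₀ : ℝ) : Measure ℝ :=
  gaussianReal 0 (Real.toNNReal (1 / (n ^ 2 * ε₀ ^ 2)))

instance (n : ℕ) (ε₀ : ℝ) : IsProbabilityMeasure (noiseLaw n ε₀) := by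
  unfold noiseLaw; infer_instance

lemma measurable_evalDist {S : Finset X} (q : StatQuery X) :
    Measurable (fun A : S → ℝ => evalDist q A) := by
  unfold evalDist; fun_prop

lemma measurable_mwUpdate {S : Finset X} (q : StatQuery X) :
    Measurable (fun p : (S → ℝ) × ℝ => mwUpdate p.1 q p.2) := by
  have h : Measurable (fun p : (S → ℝ) × ℝ => evalDist q p.1) :=
    (measurable_evalDist q).comp measurable_fst
  unfold mwUpdate
  fun_prop

lemma measurable_iterate [DecidableEq X] (Dpriv : Fin n → X) (Dpub : Fin m → X)
    (Q : Finset (StatQuery X))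
    (t : ℕ) : Measurable (iterate Dpriv Dpub Q t) := by
  induction t with
  | zero => exact measurable_const
  | succ t ih =>
    have h1 : ∀ q : Q, Measurable (fun p : (supp Dpub → ℝ) × ℝ =>
        mwUpdate p.1 q.1 (noisyAnswer Dpriv q.1 p.2)) := fun q => by
      have h2 : Measurable (fun p : (supp Dpub → ℝ) × ℝ => (p.1, noisyAnswer Dpriv q.1 p.2)) := by
        unfold noisyAnswer; fun_prop
      exact (measurable_mwUpdate q.1).comp h2
    have h3 : Measurable (fun p : Q × ((supp Dpub → ℝ) × ℝ) =>
        mwUpdate p.2.1 p.1.1 (noisyAnswer Dpriv p.1.1 p.2.2)) :=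
      measurable_from_prod_countable_right h1
    have h4 : Measurable (fun h : Transcript Q (t + 1) => (Fin.init h : Transcript Q t)) :=
      measurable_pi_lambda _ fun i => measurable_pi_apply _
    have h5 : Measurable (fun h : Transcript Q (t + 1) =>
        ((h (Fin.last t)).1, (iterate Dpriv Dpub Q t (Fin.init h), (h (Fin.last t)).2))) := by
      have := ih.comp h4
      fun_prop
    exact h3.comp h5

lemma measurable_queryProb (M : Selection) (ε₀ : ℝ) (D : Fin n → X)
    (Q : Finset (StatQuery X)) {S : Finset X} (q : Q) :
    Measurable (fun A : S → ℝ => queryProb M ε₀ D Q A q) := by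
  have hs : ∀ r : Q, Measurable (fun A : S → ℝ => |evalDist r.1 A - evalData r.1 D|) := fun r =>
    ((measurable_evalDist r.1).sub_const _).abs
  have hsup : Measurable (fun A : S → ℝ => ⨆ r : Q, |evalDist r.1 A - evalData r.1 D|) :=
    Measurable.iSup hs
  cases M
  · simp only [queryProb, selectProb, expProb]
    fun_prop
  · simp only [queryProb, selectProb, permuteFlipProb, flipProb]
    fun_prop

/-- One round: given the rounds so far, select a query with the mechanism `M` at the current
distribution, and draw independent Gaussian noise. -/
noncomputable def roundKernel [DecidableEq X] (M : Selection) (ε₀ : ℝ) (Dpriv : Fin n → X) (Dpub : Fin m → X)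
    (Q : Finset (StatQuery X)) (t : ℕ) : Kernel (Transcript Q t) (Q × ℝ) where
  toFun h := ∑ q : Q, ENNReal.ofReal (queryProb M ε₀ Dpriv Q (iterate Dpriv Dpub Q t h) q) •
    ((Measure.dirac q).prod (noiseLaw n ε₀))
  measurable' := by
    refine Measure.measurable_of_measurable_coe _ fun s hs => ?_
    simp only [Measure.coe_finsetSum, Finset.sum_apply, Measure.smul_apply, smul_eq_mul]
    refine Finset.measurable_sum _ fun q _ => Measurable.mul_const ?_ _
    exact ((measurable_queryProb M ε₀ Dpriv Q q).comp
      (measurable_iterate Dpriv Dpub Q t)).ennreal_ofReal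

/-- The joint law of the first `t` rounds. -/
noncomputable def transcriptLaw [DecidableEq X] (M : Selection) (ε₀ : ℝ) (Dpriv : Fin n → X)
    (Dpub : Fin m → X) (Q : Finset (StatQuery X)) : (t : ℕ) → Measure (Transcript Q t)
  | 0 => Measure.dirac Fin.elim0
  | t + 1 => ((transcriptLaw M ε₀ Dpriv Dpub Q t) ⊗ₘ (roundKernel M ε₀ Dpriv Dpub Q t)).map
      (fun p => Fin.snoc (α := fun _ => Q × ℝ) p.1 p.2)

/-- The law of all the random choices of the algorithm, run for `T` rounds with privacy
parameter `ε`. -/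
noncomputable def runLaw [DecidableEq X] (M : Selection) (ε : ℝ) (T : ℕ) (Dpriv : Fin n → X)
    (Dpub : Fin m → X) (Q : Finset (StatQuery X)) : Measure (Transcript Q T) :=
  transcriptLaw M (roundEps ε T) Dpriv Dpub Q T

/-- For a nonempty query class each round is a genuine random draw. -/
lemma isMarkovKernel_roundKernel [DecidableEq X] (M : Selection) {ε₀ : ℝ} (hε : 0 ≤ ε₀)
    (Dpriv : Fin n → X) (Dpub : Fin m → X) {Q : Finset (StatQuery X)} (hQ : Q.Nonempty) (t : ℕ) :
    IsMarkovKernel (roundKernel M ε₀ Dpriv Dpub Q t) := by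
  have : Nonempty Q := hQ.to_subtype
  refine ⟨fun h => ⟨?_⟩⟩
  change (∑ q : Q, ENNReal.ofReal (queryProb M ε₀ Dpriv Q (iterate Dpriv Dpub Q t h) q) •
    ((Measure.dirac q).prod (noiseLaw n ε₀))) Set.univ = 1
  simp only [Measure.coe_finsetSum, Finset.sum_apply, Measure.smul_apply, smul_eq_mul,
    measure_univ, mul_one]
  simp only [queryProb]
  rw [← ENNReal.ofReal_sum_of_nonneg
    (fun q _ => selectProb_nonneg M (by positivity) _ q), sum_selectProb, ENNReal.ofReal_one]

lemma measurable_snoc (Q : Finset (StatQuery X)) (t : ℕ) :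
    Measurable (fun p : Transcript Q t × (Q × ℝ) =>
      (Fin.snoc (α := fun _ => Q × ℝ) p.1 p.2 : Transcript Q (t + 1))) := by
  refine measurable_pi_lambda _ fun i => ?_
  refine Fin.lastCases ?_ (fun j => ?_) i
  · simpa using measurable_snd
  · simp only [Fin.snoc_castSucc]
    exact (measurable_pi_apply j).comp measurable_fst

lemma isProbabilityMeasure_transcriptLaw [DecidableEq X] (M : Selection) {ε₀ : ℝ} (hε : 0 ≤ ε₀)
    (Dpriv : Fin n → X) (Dpub : Fin m → X) {Q : Finset (StatQuery X)} (hQ : Q.Nonempty)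
    (t : ℕ) : IsProbabilityMeasure (transcriptLaw M ε₀ Dpriv Dpub Q t) := by
  induction t with
  | zero => rw [transcriptLaw]; infer_instance
  | succ t ih =>
    have := isMarkovKernel_roundKernel M hε Dpriv Dpub hQ t
    rw [transcriptLaw]
    exact Measure.isProbabilityMeasure_map (measurable_snoc Q t).aemeasurable

end Algorithm

end PMWPub

open PMWPub

namespace PMWPub

/-! ### Deterministic analysis of multiplicative weights along a fixed transcript. -/

section Deterministic

variable {X : Type u} {n m : ℕ}

/-! Fix a comparator `μ` on the public support, with maximal error `F`. The potential is `∑ x, μ x *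
log (A x)`. By `mwUpdate_progress` a round raises it by at least a quarter of `(q(A) - q(μ))² - (a -
q(μ))²`, where `q` is the selected query and `a` its clipped answer. The potential starts at `-log
m` or above and never exceeds `0`, so summing gives `sum_sq_error_le`. Clipping does not increase
the noise, hence `|a - q(μ)| ≤ |z| + F`. Cauchy–Schwarz then bounds the average error on the
selected queries by `2F + √(4 log m / T + V)`, where `V` bounds the mean squared noise
(`sum_selected_error_le`). The maximal error is convex, so the output costs only the average
selection gap on top (`maxError_output_le_of_good`).

Only two sums are random, and a Chernoff bound for adapted sums controls both
(`transcriptLaw_sum_ge_le`). For the squared noise, `exp (z² / (4v))` has mean `√2`. For the gap,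
either mechanism returns a query of gap `g` with probability at most `exp (-c g)`. Jensen's
inequality therefore bounds the conditional mean gap by `log |Q| / c`, and Hoeffding's lemma handles
the deviation, since gaps lie in `[0,1]`. Each sum is too large with probability at most `β / 3`.

For the asymptotic form, either the claimed bound is trivial (at least `1`, or `m = 1`), or `n ε
√(log m) / log |Q|` dominates `log (1 / β)`. In the latter case `T` is of the order of the former
quantity, and every term of the explicit bound is of the target order. -/

lemma evalData_mem_Icc (q : StatQuery X) (D : Fin n → X) : evalData q D ∈ Set.Icc (0 : ℝ) 1 := by
  refine ⟨div_nonneg (Finset.sum_nonneg fun i _ => (q (D i)).2.1) (by positivity), ?_⟩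
  refine div_le_one_of_le₀ ?_ (by positivity)
  calc ∑ i, (q (D i) : ℝ) ≤ ∑ _i : Fin n, (1 : ℝ) := Finset.sum_le_sum fun i _ => (q (D i)).2.2
    _ = n := by simp

lemma evalDist_mem_Icc {S : Finset X} (q : StatQuery X) {A : S → ℝ} (hA : A ∈ stdSimplex ℝ S) :
    evalDist q A ∈ Set.Icc (0 : ℝ) 1 := by
  refine ⟨Finset.sum_nonneg fun x _ => mul_nonneg (hA.1 x) (q x).2.1, ?_⟩
  rw [← hA.2]
  exact Finset.sum_le_sum fun x _ => mul_le_of_le_one_right (hA.1 x) (q x).2.2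

lemma abs_evalDist_sub_evalData_mem_Icc {S : Finset X} (q : StatQuery X) {A : S → ℝ}
    (hA : A ∈ stdSimplex ℝ S) (D : Fin n → X) :
    |evalDist q A - evalData q D| ∈ Set.Icc (0 : ℝ) 1 := by
  refine ⟨abs_nonneg _, abs_le.2 ?_⟩
  have h1 := evalDist_mem_Icc q hA
  have h2 := evalData_mem_Icc q D
  constructor <;> linarith [h1.1, h1.2, h2.1, h2.2]

lemma abs_sub_le_maxError {S : Finset X} {Q : Finset (StatQuery X)} (D : Fin n → X) (A : S → ℝ)
    (q : Q) : |evalDist q.1 A - evalData q.1 D| ≤ maxError Q D A :=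
  le_ciSup (f := fun q : Q => |evalDist q.1 A - evalData q.1 D|)
    (Set.finite_range _).bddAbove q

lemma maxError_nonneg {S : Finset X} (Q : Finset (StatQuery X)) (D : Fin n → X) (A : S → ℝ) :
    0 ≤ maxError Q D A :=
  Real.iSup_nonneg fun _ => abs_nonneg _

lemma maxError_le_one {S : Finset X} {Q : Finset (StatQuery X)} (hQ : Q.Nonempty) (D : Fin n → X)
    {A : S → ℝ} (hA : A ∈ stdSimplex ℝ S) : maxError Q D A ≤ 1 := by
  have : Nonempty Q := hQ.to_subtype
  exact ciSup_le fun q => (abs_evalDist_sub_evalData_mem_Icc q.1 hA D).2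

lemma bestMixtureError_nonneg (D : Fin n → X) (Q : Finset (StatQuery X)) (S : Finset X) :
    0 ≤ bestMixtureError D Q S :=
  Real.iInf_nonneg fun _ => maxError_nonneg _ _ _

section Update

variable {S : Finset X} {A : S → ℝ}

lemma mwUpdate_normalizer_pos (hA : A ∈ stdSimplex ℝ S) (q : StatQuery X) (r : ℝ) :
    0 < ∑ y : S, A y * Real.exp ((q y : ℝ) * r / 2) := by
  have hn : ∀ y ∈ Finset.univ, 0 ≤ A y * Real.exp ((q y : ℝ) * r / 2) := fun y _ =>
    mul_nonneg (hA.1 y) (Real.exp_pos _).le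
  refine lt_of_le_of_ne (Finset.sum_nonneg hn) fun h0 => ?_
  have h := (Finset.sum_eq_zero_iff_of_nonneg hn).1 h0.symm
  have h1 : ∑ y, A y = 0 := Finset.sum_eq_zero fun y hy =>
    (mul_eq_zero.1 (h y hy)).resolve_right (Real.exp_pos _).ne'
  rw [hA.2] at h1
  exact one_ne_zero h1

lemma mwUpdate_mem_stdSimplex (hA : A ∈ stdSimplex ℝ S) (q : StatQuery X) (a : ℝ) :
    mwUpdate A q a ∈ stdSimplex ℝ S := by
  have hZ := mwUpdate_normalizer_pos hA q (a - evalDist q A)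
  refine ⟨fun x => div_nonneg (mul_nonneg (hA.1 x) (Real.exp_pos _).le) hZ.le, ?_⟩
  simp only [mwUpdate, ← Finset.sum_div]
  exact div_self hZ.ne'

lemma mwUpdate_pos (hA : A ∈ stdSimplex ℝ S) (hpos : ∀ x, 0 < A x) (q : StatQuery X) (a : ℝ)
    (x : S) : 0 < mwUpdate A q a x :=
  div_pos (mul_pos (hpos x) (Real.exp_pos _)) (mwUpdate_normalizer_pos hA q _)

/-- Progress of the multiplicative weights update, measured by the cross entropy to `μ`. -/
lemma mwUpdate_progress (hA : A ∈ stdSimplex ℝ S) (hpos : ∀ x, 0 < A x) {μ : S → ℝ}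
    (hμ : μ ∈ stdSimplex ℝ S) (q : StatQuery X) {a : ℝ} (ha : a ∈ Set.Icc (0 : ℝ) 1) :
    ((evalDist q A - evalDist q μ) ^ 2 - (a - evalDist q μ) ^ 2) / 4 ≤
      ∑ x, μ x * Real.log (mwUpdate A q a x) - ∑ x, μ x * Real.log (A x) := by
  set r := a - evalDist q A with hr
  have hqA := evalDist_mem_Icc q hA
  have hr1 : |r / 2| ≤ 1 := abs_le.2
    ⟨by linarith [ha.1, ha.2, hqA.1, hqA.2], by linarith [ha.1, ha.2, hqA.1, hqA.2]⟩
  set Z := ∑ y : S, A y * Real.exp ((q y : ℝ) * r / 2) with hZdef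
  have hZ : 0 < Z := mwUpdate_normalizer_pos hA q r
  have hlog : ∀ x, Real.log (mwUpdate A q a x)
      = Real.log (A x) + (q x : ℝ) * r / 2 - Real.log Z := fun x => by
    rw [mwUpdate, Real.log_div (mul_pos (hpos x) (Real.exp_pos _)).ne' hZ.ne',
      Real.log_mul (hpos x).ne' (Real.exp_pos _).ne', Real.log_exp]
  -- Uses `exp u ≤ 1 + u + u²` for `|u| ≤ 1`, which applies because answers and query values lie in
  -- `[0,1]`.
  have hZle : Z ≤ 1 + evalDist q A * (r / 2) + (r / 2) ^ 2 := by
    have hterm : ∀ y : S, A y * Real.exp ((q y : ℝ) * r / 2) ≤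
        A y + A y * (q y : ℝ) * (r / 2) + A y * (r / 2) ^ 2 := fun y => by
      have hq0 := (q y).2.1
      have hq1 := (q y).2.2
      have habs : |(q y : ℝ) * r / 2| ≤ |r / 2| := by
        rw [mul_div_assoc, abs_mul, abs_of_nonneg hq0]
        exact mul_le_of_le_one_left (abs_nonneg _) hq1
      have h1 := (abs_le.1 (Real.abs_exp_sub_one_sub_id_le (habs.trans hr1))).2
      have h2 := sq_le_sq.2 habs
      have h3 : Real.exp ((q y : ℝ) * r / 2) ≤ 1 + (q y : ℝ) * (r / 2) + (r / 2) ^ 2 := by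
        linarith
      calc _ ≤ A y * (1 + (q y : ℝ) * (r / 2) + (r / 2) ^ 2) :=
            mul_le_mul_of_nonneg_left h3 (hA.1 y)
        _ = _ := by ring
    calc Z ≤ ∑ y : S, (A y + A y * (q y : ℝ) * (r / 2) + A y * (r / 2) ^ 2) :=
          Finset.sum_le_sum fun y _ => hterm y
      _ = _ := by
          rw [Finset.sum_add_distrib, Finset.sum_add_distrib, ← Finset.sum_mul, ← Finset.sum_mul,
            hA.2, one_mul, evalDist]
  have hlogZ : Real.log Z ≤ evalDist q A * (r / 2) + (r / 2) ^ 2 := by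
    linarith [Real.log_le_sub_one_of_pos hZ]
  have hsum : ∑ x, μ x * Real.log (mwUpdate A q a x) - ∑ x, μ x * Real.log (A x)
      = evalDist q μ * (r / 2) - Real.log Z := by
    rw [← Finset.sum_sub_distrib]
    calc _ = ∑ x, (μ x * (q x : ℝ) * (r / 2) - μ x * Real.log Z) :=
          Finset.sum_congr rfl fun x _ => by rw [hlog]; ring
      _ = _ := by rw [Finset.sum_sub_distrib, ← Finset.sum_mul, ← Finset.sum_mul, hμ.2, one_mul,
        evalDist]
  rw [hsum]
  -- Completing the square: the step size `1/2` is what makes the linear gain minus the quadratic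
  -- loss an exact difference of squares.
  have hid : ((evalDist q A - evalDist q μ) ^ 2 - (a - evalDist q μ) ^ 2) / 4
      = evalDist q μ * (r / 2) - (evalDist q A * (r / 2) + (r / 2) ^ 2) := by
    rw [hr]; ring
  linarith

end Update

lemma noisyAnswer_mem_Icc (D : Fin n → X) (q : StatQuery X) (z : ℝ) :
    noisyAnswer D q z ∈ Set.Icc (0 : ℝ) 1 :=
  ⟨le_max_left _ _, max_le zero_le_one (min_le_left _ _)⟩

lemma abs_noisyAnswer_sub_le (D : Fin n → X) (q : StatQuery X) (z : ℝ) :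
    |noisyAnswer D q z - evalData q D| ≤ |z| := by
  obtain ⟨h0, h1⟩ := evalData_mem_Icc q D
  unfold noisyAnswer
  rcases max_cases 0 (min 1 (evalData q D + z)) with ⟨e, h⟩ | ⟨e, h⟩ <;> rw [e] <;>
  rcases min_cases 1 (evalData q D + z) with ⟨e', h'⟩ | ⟨e', h'⟩ <;> rw [abs_le] <;>
  constructor <;> (try rw [e']) <;> linarith [neg_abs_le z, le_abs_self z]

variable [DecidableEq X]

/-- This uniform lower bound is the source of the `log m` term: it limits how low the potential can
start, for any comparator. -/
lemma one_div_le_empirical (D : Fin m → X) (x : supp D) : 1 / (m : ℝ) ≤ empirical D x := by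
  obtain ⟨i, -, hi⟩ := Finset.mem_image.1 x.2
  refine div_le_div_of_nonneg_right ?_ (by positivity)
  exact_mod_cast Finset.card_pos.2 ⟨i, by simp [hi]⟩

lemma empirical_mem_stdSimplex (hm : 0 < m) (D : Fin m → X) :
    empirical D ∈ stdSimplex ℝ (supp D) := by
  refine ⟨fun x => div_nonneg (by positivity) (by positivity), ?_⟩
  simp only [empirical, ← Finset.sum_div]
  have h : ∑ x : supp D, (Finset.univ.filter (fun i => D i = x)).card = m := by
    rw [Finset.sum_coe_sort (supp D) (fun x => (Finset.univ.filter (fun i => D i = x)).card)]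
    rw [← Finset.card_eq_sum_card_fiberwise
      (fun i _ => by simp [supp] : Set.MapsTo D (Finset.univ : Finset (Fin m)) (supp D))]
    simp
  rw [← Nat.cast_sum, h]
  exact div_self (by positivity)

variable (Dpriv : Fin n → X) (Dpub : Fin m → X) (Q : Finset (StatQuery X))

lemma iterate_mem_stdSimplex (hm : 0 < m) (t : ℕ) (h : Transcript Q t) :
    iterate Dpriv Dpub Q t h ∈ stdSimplex ℝ (supp Dpub) := by
  induction t with
  | zero => exact empirical_mem_stdSimplex hm Dpub
  | succ t ih => exact mwUpdate_mem_stdSimplex (ih _) _ _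

lemma iterate_pos (hm : 0 < m) (t : ℕ) (h : Transcript Q t) :
    ∀ x, 0 < iterate Dpriv Dpub Q t h x := by
  induction t with
  | zero =>
    intro x
    exact (by positivity : 0 < 1 / (m : ℝ)).trans_le (one_div_le_empirical Dpub x)
  | succ t ih => exact mwUpdate_pos (iterate_mem_stdSimplex _ _ _ hm t _) (ih _) _ _

variable {Q}

/-- The distribution `A_t` at the start of round `t + 1` of a longer run. -/
noncomputable def roundDist {T : ℕ} (h : Transcript Q T) (t : Fin T) : supp Dpub → ℝ :=
  iterate Dpriv Dpub Q t (fun i => h (Fin.castLE t.2.le i))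

variable {Dpriv Dpub}

lemma roundDist_mem_stdSimplex (hm : 0 < m) {T : ℕ} (h : Transcript Q T) (t : Fin T) :
    roundDist Dpriv Dpub h t ∈ stdSimplex ℝ (supp Dpub) :=
  iterate_mem_stdSimplex _ _ _ hm _ _

lemma sum_progress_le {μ : supp Dpub → ℝ} (hm : 0 < m) (hμ : μ ∈ stdSimplex ℝ (supp Dpub)) {T : ℕ}
    (h : Transcript Q T) :
    ∑ t, ((evalDist (h t).1.1 (roundDist Dpriv Dpub h t) - evalDist (h t).1.1 μ) ^ 2
        - (noisyAnswer Dpriv (h t).1.1 (h t).2 - evalDist (h t).1.1 μ) ^ 2) / 4 ≤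
      ∑ x, μ x * Real.log (iterate Dpriv Dpub Q T h x) - ∑ x, μ x * Real.log (empirical Dpub x) := by
  induction T with
  | zero => simp [iterate]
  | succ T ih =>
    rw [Fin.sum_univ_castSucc]
    have h1 := ih (Fin.init h)
    have h2 := mwUpdate_progress (iterate_mem_stdSimplex Dpriv Dpub Q hm T (Fin.init h))
      (iterate_pos Dpriv Dpub Q hm T (Fin.init h)) hμ (h (Fin.last T)).1.1
      (noisyAnswer_mem_Icc Dpriv (h (Fin.last T)).1.1 (h (Fin.last T)).2)
    have h3 := add_le_add h1 h2
    -- The distributions of the first `T` rounds agree definitionally for `h` and `Fin.init h`, so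
    -- only the telescoping remains.
    refine h3.trans' (le_of_eq rfl) |>.trans (le_of_eq ?_)
    rw [iterate]
    ring

lemma sum_sq_error_le {μ : supp Dpub → ℝ} (hm : 0 < m) (hμ : μ ∈ stdSimplex ℝ (supp Dpub)) {T : ℕ}
    (h : Transcript Q T) :
    ∑ t, (evalDist (h t).1.1 (roundDist Dpriv Dpub h t) - evalDist (h t).1.1 μ) ^ 2 ≤
      4 * Real.log m +
        ∑ t, (noisyAnswer Dpriv (h t).1.1 (h t).2 - evalDist (h t).1.1 μ) ^ 2 := by
  have h1 := sum_progress_le (Dpriv := Dpriv) hm hμ h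
  rw [← Finset.sum_div, Finset.sum_sub_distrib] at h1
  have h2 : ∑ x, μ x * Real.log (iterate Dpriv Dpub Q T h x) ≤ 0 :=
    Finset.sum_nonpos fun x _ => mul_nonpos_of_nonneg_of_nonpos (hμ.1 x)
      (Real.log_nonpos (iterate_pos Dpriv Dpub Q hm T h x).le
        (mem_Icc_of_mem_stdSimplex (iterate_mem_stdSimplex Dpriv Dpub Q hm T h) x).2)
  have h3 : -Real.log m ≤ ∑ x, μ x * Real.log (empirical Dpub x) := by
    calc -Real.log m = ∑ x, μ x * (-Real.log m) := by rw [← Finset.sum_mul, hμ.2, one_mul]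
      _ ≤ _ := Finset.sum_le_sum fun x _ => mul_le_mul_of_nonneg_left (by
          rw [← Real.log_inv, ← one_div]
          exact Real.log_le_log (by positivity) (one_div_le_empirical Dpub x)) (hμ.1 x)
  linarith

/-- The comparator's error is paid twice: once because the answers track the data rather than `μ`,
and once in returning from `q(μ)` to `q(D)`. -/
lemma sum_selected_error_le {μ : supp Dpub → ℝ} (hm : 0 < m) (hμ : μ ∈ stdSimplex ℝ (supp Dpub))
    {T : ℕ} (hT : 0 < T) (h : Transcript Q T) {V : ℝ} (hV : 0 ≤ V) (hz : ∑ t, (h t).2 ^ 2 ≤ T * V) :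
    ∑ t, |evalDist (h t).1.1 (roundDist Dpriv Dpub h t) - evalData (h t).1.1 Dpriv| ≤
      T * (2 * maxError Q Dpriv μ + Real.sqrt (4 * Real.log m / T + V)) := by
  have hT' : (0 : ℝ) < T := Nat.cast_pos.2 hT
  set F := maxError Q Dpriv μ
  have hF : 0 ≤ F := maxError_nonneg _ _ _
  set e := fun t => evalDist (h t).1.1 (roundDist Dpriv Dpub h t)
  set w := fun t => evalDist (h t).1.1 μ
  have hlog : 0 ≤ Real.log m := Real.log_natCast_nonneg m
  have habs : ∑ t, |(h t).2| ≤ T * Real.sqrt V := by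
    have h1 := sq_sum_le_card_mul_sum_sq (s := Finset.univ) (f := fun t => |(h t).2|)
    simp only [sq_abs, Finset.card_univ, Fintype.card_fin] at h1
    refine abs_le_of_sq_le_sq' ?_ (by positivity) |>.2
    rw [mul_pow, Real.sq_sqrt hV]
    nlinarith
  have hans : ∑ t, (noisyAnswer Dpriv (h t).1.1 (h t).2 - w t) ^ 2
      ≤ T * (V + 2 * F * Real.sqrt V + F ^ 2) := by
    calc _ ≤ ∑ t, ((h t).2 ^ 2 + 2 * F * |(h t).2| + F ^ 2) := by
          refine Finset.sum_le_sum fun t _ => ?_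
          have h1 : |noisyAnswer Dpriv (h t).1.1 (h t).2 - w t| ≤ |(h t).2| + F := by
            refine (abs_sub_le _ (evalData (h t).1.1 Dpriv) _).trans
              (add_le_add (abs_noisyAnswer_sub_le _ _ _) ?_)
            rw [abs_sub_comm]
            exact abs_sub_le_maxError Dpriv μ (h t).1
          have h2 := sq_le_sq' (by
            linarith [abs_nonneg (noisyAnswer Dpriv (h t).1.1 (h t).2 - w t),
            abs_nonneg (h t).2]) h1
          rw [sq_abs] at h2
          rw [add_sq, sq_abs] at h2
          linarith
      _ = ∑ t, (h t).2 ^ 2 + 2 * F * ∑ t, |(h t).2| + T * F ^ 2 := by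
          simp [Finset.sum_add_distrib, Finset.mul_sum]
      _ ≤ T * V + 2 * F * (T * Real.sqrt V) + T * F ^ 2 := by gcongr
      _ = _ := by ring
  set B := Real.sqrt (4 * Real.log m / T + V)
  have hB : B ^ 2 = 4 * Real.log m / T + V := Real.sq_sqrt (by positivity)
  -- Replacing `√V` by `B` in the cross term makes the bound below a perfect square `(B + F)²`.
  have hVB : Real.sqrt V ≤ B := Real.sqrt_le_sqrt (by linarith [show 0 ≤ 4 * Real.log m / T by positivity])
  have hsum : ∑ t, |e t - w t| ≤ T * (B + F) := by
    have h1 := sq_sum_le_card_mul_sum_sq (s := Finset.univ) (f := fun t => |e t - w t|)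
    simp only [sq_abs, Finset.card_univ, Fintype.card_fin] at h1
    refine abs_le_of_sq_le_sq' ?_ (by positivity) |>.2
    calc _ ≤ (T : ℝ) * (4 * Real.log m + T * (V + 2 * F * Real.sqrt V + F ^ 2)) :=
          h1.trans (mul_le_mul_of_nonneg_left
            ((sum_sq_error_le hm hμ h).trans (by gcongr)) hT'.le)
      _ = (T : ℝ) ^ 2 * (B ^ 2 + 2 * F * Real.sqrt V + F ^ 2) := by rw [hB]; field_simp; ring
      _ ≤ (T : ℝ) ^ 2 * (B ^ 2 + 2 * F * B + F ^ 2) := by gcongr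
      _ = _ := by ring
  calc ∑ t, |e t - evalData (h t).1.1 Dpriv| ≤ ∑ t, (|e t - w t| + F) :=
        Finset.sum_le_sum fun t _ => (abs_sub_le _ (w t) _).trans
          (add_le_add le_rfl (abs_sub_le_maxError Dpriv μ (h t).1))
    _ = ∑ t, |e t - w t| + T * F := by simp [Finset.sum_add_distrib]
    _ ≤ _ := by linarith

lemma output_mem_stdSimplex (hm : 0 < m) {T : ℕ} (hT : 0 < T) (h : Transcript Q T) :
    output Dpriv Dpub Q T h ∈ stdSimplex ℝ (supp Dpub) := by
  have hT' : (T : ℝ) ≠ 0 := Nat.cast_ne_zero.2 hT.ne'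
  refine ⟨fun x => div_nonneg (Finset.sum_nonneg fun t _ =>
    (roundDist_mem_stdSimplex hm h t).1 x) (by positivity), ?_⟩
  change ∑ x, (∑ t, roundDist Dpriv Dpub h t x) / (T : ℝ) = 1
  rw [← Finset.sum_div, Finset.sum_comm, Finset.sum_congr rfl fun t _ =>
    (roundDist_mem_stdSimplex (Dpriv := Dpriv) hm h t).2]
  simp [hT']

lemma evalDist_output (q : StatQuery X) {T : ℕ} (h : Transcript Q T) :
    evalDist q (output Dpriv Dpub Q T h) = (∑ t, evalDist q (roundDist Dpriv Dpub h t)) / T := by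
  simp only [evalDist, output, roundDist]
  rw [Finset.sum_comm, Finset.sum_div]
  refine Finset.sum_congr rfl fun x _ => ?_
  rw [← Finset.sum_mul]
  ring

/-- The maximal error is convex, and the output is the average of the round distributions. -/
lemma maxError_output_le (hQ : Q.Nonempty) {T : ℕ} (hT : 0 < T) (h : Transcript Q T) :
    T * maxError Q Dpriv (output Dpriv Dpub Q T h)
      ≤ ∑ t, maxError Q Dpriv (roundDist Dpriv Dpub h t) := by
  have : Nonempty Q := hQ.to_subtype
  have hT' : (0 : ℝ) < T := Nat.cast_pos.2 hT
  rw [mul_comm, ← le_div_iff₀ hT']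
  refine ciSup_le fun q => ?_
  rw [evalDist_output, le_div_iff₀ hT', ← abs_of_pos hT', ← abs_mul, abs_of_pos hT', sub_mul,
    div_mul_cancel₀ _ hT'.ne']
  have h1 : ∑ t, evalDist q.1 (roundDist Dpriv Dpub h t) - evalData q.1 Dpriv * T
      = ∑ t, (evalDist q.1 (roundDist Dpriv Dpub h t) - evalData q.1 Dpriv) := by
    simp [Finset.sum_sub_distrib, mul_comm]
  rw [h1]
  exact (Finset.abs_sum_le_sum_abs _ _).trans
    (Finset.sum_le_sum fun t _ => abs_sub_le_maxError Dpriv _ q)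

/-- How much larger the largest score was than the selected one, in a given round. -/
noncomputable def selectionGap (D : Fin n → X) {S : Finset X} (A : S → ℝ) (q : Q) : ℝ :=
  maxError Q D A - |evalDist q.1 A - evalData q.1 D|

/-- The error bound for a run in which the noise and the selection are well behaved. -/
lemma maxError_output_le_of_good (hm : 0 < m) (hQ : Q.Nonempty) {T : ℕ} (hT : 0 < T)
    (h : Transcript Q T) {V G : ℝ} (hV : 0 ≤ V) (hz : ∑ t, (h t).2 ^ 2 ≤ T * V)
    (hG : ∑ t, selectionGap Dpriv (roundDist Dpriv Dpub h t) (h t).1 ≤ T * G) :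
    maxError Q Dpriv (output Dpriv Dpub Q T h) ≤
      2 * bestMixtureError Dpriv Q (supp Dpub) + Real.sqrt (4 * Real.log m / T + V) + G := by
  have hT' : (0 : ℝ) < T := Nat.cast_pos.2 hT
  have : Nonempty (stdSimplex ℝ (supp Dpub)) := ⟨_, empirical_mem_stdSimplex hm Dpub⟩
  -- Solving for the best mixture error lets the bound be checked for each `μ` separately, so no
  -- minimiser has to be produced.
  suffices hs : (maxError Q Dpriv (output Dpriv Dpub Q T h)
      - Real.sqrt (4 * Real.log m / T + V) - G) / 2 ≤ bestMixtureError Dpriv Q (supp Dpub) by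
    linarith
  refine le_ciInf fun μ => ?_
  have h1 := maxError_output_le (Dpriv := Dpriv) (Dpub := Dpub) hQ hT h
  have h2 := sum_selected_error_le (μ := (μ : supp Dpub → ℝ)) (Dpriv := Dpriv) hm μ.2 hT h hV hz
  simp only [selectionGap, Finset.sum_sub_distrib] at hG
  have h3 := le_of_mul_le_mul_left (h1.trans (by linarith :
    _ ≤ (T : ℝ) * (2 * maxError Q Dpriv (μ : supp Dpub → ℝ)
      + Real.sqrt (4 * Real.log m / T + V) + G))) hT'
  linarith

end Deterministic

/-! ### Concentration of the noise and of the selection gap. -/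

section Probability

/-- Hoeffding's lemma for a finitely supported random variable with values in `[0,1]`. -/
lemma sum_mul_exp_le_of_mem_Icc {ι : Type*} [Fintype ι] {p Y : ι → ℝ} (hp : p ∈ stdSimplex ℝ ι)
    (hY : ∀ i, Y i ∈ Set.Icc (0 : ℝ) 1) (l : ℝ) :
    ∑ i, p i * Real.exp (l * Y i) ≤ Real.exp (l * ∑ i, p i * Y i + l ^ 2 / 8) := by
  let _ : MeasurableSpace ι := ⊤
  have : DiscreteMeasurableSpace ι := ⟨fun _ => trivial⟩
  let ν : Measure ι := ∑ i, ENNReal.ofReal (p i) • Measure.dirac i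
  have hν : IsProbabilityMeasure ν := ⟨by
    simp only [ν, Measure.coe_finsetSum, Finset.sum_apply, Measure.smul_apply, smul_eq_mul,
      measure_univ, mul_one]
    rw [← ENNReal.ofReal_sum_of_nonneg fun i _ => hp.1 i, hp.2, ENNReal.ofReal_one]⟩
  have hint : ∀ f : ι → ℝ, ∫ i, f i ∂ν = ∑ i, p i * f i := fun f => by
    have hfin : ∀ i, IsFiniteMeasure (ENNReal.ofReal (p i) • Measure.dirac i) := fun i =>
      Measure.smul_finite _ ENNReal.ofReal_ne_top
    rw [integral_finsetSum_measure fun i _ => Integrable.of_finite]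
    refine Finset.sum_congr rfl fun i _ => ?_
    rw [integral_smul_measure, integral_dirac, ENNReal.toReal_ofReal (hp.1 i), smul_eq_mul]
  have h := (hasSubgaussianMGF_of_mem_Icc (μ := ν) (X := Y) (a := 0) (b := 1)
    (Measurable.of_discrete.aemeasurable) (Filter.Eventually.of_forall hY)).mgf_le l
  rw [mgf, hint, hint] at h
  set E := ∑ i, p i * Y i
  have h1 : ∑ i, p i * Real.exp (l * (Y i - E)) = (∑ i, p i * Real.exp (l * Y i)) / Real.exp (l * E) := by
    rw [Finset.sum_div]
    refine Finset.sum_congr rfl fun i _ => ?_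
    rw [mul_sub, Real.exp_sub, mul_div_assoc]
  rw [h1, div_le_iff₀ (Real.exp_pos _), ← Real.exp_add] at h
  refine h.trans_eq (congrArg _ ?_)
  norm_num
  ring

variable {ι : Type u} [Fintype ι]

/-- Both mechanisms return a candidate with at most its permute-and-flip acceptance probability. -/
lemma selectProb_le_flipProb (M : Selection) {c : ℝ} (hc : 0 ≤ c) (s : ι → ℝ) (i : ι) :
    selectProb M c s i ≤ flipProb c s i := by
  have : Nonempty ι := ⟨i⟩
  cases M
  · obtain ⟨k, hk⟩ := exists_eq_ciSup_of_finite (f := s)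
    simp only [selectProb, expProb, flipProb, ← hk]
    -- The normaliser contains the term of a best candidate `k`.
    rw [mul_sub, Real.exp_sub]
    exact div_le_div_of_nonneg_left (Real.exp_pos _).le (Real.exp_pos _)
      (Finset.single_le_sum (f := fun j => Real.exp (c * s j)) (fun j _ => (Real.exp_pos _).le)
        (Finset.mem_univ k))
  · classical
    simp only [selectProb, permuteFlipProb]
    rw [div_le_iff₀ (by positivity)]
    -- In any order, the probability of rejecting all earlier candidates is at most `1`.
    calc _ ≤ ∑ _σ : ι ≃ Fin (Fintype.card ι), flipProb c s i :=
          Finset.sum_le_sum fun σ _ => mul_le_of_le_one_right (Real.exp_pos _).le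
            (Finset.prod_le_one (fun j _ => sub_nonneg.2 (flipProb_le_one hc s j))
              fun j _ => sub_le_self _ (Real.exp_pos _).le)
      _ = _ := by
          rw [Finset.sum_const, Finset.card_univ, Fintype.card_equiv (Fintype.equivFin ι)]
          simp [mul_comm]

/-- The expected gap between the best score and the selected one. -/
lemma sum_selectProb_mul_gap_le [Nonempty ι] (M : Selection) {c : ℝ} (hc : 0 < c) (s : ι → ℝ) :
    ∑ i, selectProb M c s i * ((⨆ j, s j) - s i) ≤ Real.log (Fintype.card ι) / c := by
  rw [le_div_iff₀ hc, Real.le_log_iff_exp_le (by exact_mod_cast Fintype.card_pos)]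
  -- Jensen: `exp` of `c` times the mean gap is at most the mean of `exp (c * gap)`, where each
  -- candidate contributes at most `1`.
  have hJ := convexOn_exp.map_sum_le (t := Finset.univ) (w := selectProb M c s)
    (p := fun i => c * ((⨆ j, s j) - s i)) (fun i _ => selectProb_nonneg M hc.le s i)
    (sum_selectProb M c s) (fun i _ => Set.mem_univ _)
  simp only [smul_eq_mul] at hJ
  calc _ = Real.exp (∑ i, selectProb M c s i * (c * ((⨆ j, s j) - s i))) := by
        rw [Finset.sum_mul]
        exact congrArg _ (Finset.sum_congr rfl fun i _ => by ring)
    _ ≤ _ := hJ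
    _ ≤ ∑ _i : ι, (1 : ℝ) := Finset.sum_le_sum fun i _ => by
        calc _ ≤ flipProb c s i * Real.exp (c * ((⨆ j, s j) - s i)) :=
              mul_le_mul_of_nonneg_right (selectProb_le_flipProb M hc.le s i) (Real.exp_pos _).le
          _ = 1 := by
              rw [flipProb, ← Real.exp_add, ← mul_add]
              simp
    _ = _ := by simp

/-- The moment generating function of the selection gap. -/
lemma sum_selectProb_mul_exp_gap_le [Nonempty ι] (M : Selection) {c : ℝ} (hc : 0 < c) {s : ι → ℝ}
    (hs : ∀ i, s i ∈ Set.Icc (0 : ℝ) 1) {l : ℝ} (hl : 0 ≤ l) :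
    ∑ i, selectProb M c s i * Real.exp (l * ((⨆ j, s j) - s i)) ≤
      Real.exp (l * (Real.log (Fintype.card ι) / c) + l ^ 2 / 8) := by
  refine (sum_mul_exp_le_of_mem_Icc ⟨fun i => selectProb_nonneg M hc.le s i, sum_selectProb M c s⟩
    (fun i => ⟨sub_nonneg.2 (le_ciSup (Set.finite_range s).bddAbove i), ?_⟩) l).trans ?_
  · have := ciSup_le fun j => (hs j).2
    linarith [(hs i).1]
  · have := sum_selectProb_mul_gap_le M hc s
    gcongr

/-- The exponential moment of the square of a centred Gaussian. -/
lemma lintegral_exp_sq_gaussianReal {v : NNReal} (hv : v ≠ 0) :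
    ∫⁻ z, ENNReal.ofReal (Real.exp (z ^ 2 / (4 * v))) ∂(gaussianReal 0 v)
      = ENNReal.ofReal (Real.sqrt 2) := by
  have hv' : (0 : ℝ) < v := by positivity
  rw [gaussianReal_of_var_ne_zero _ hv,
    lintegral_withDensity_eq_lintegral_mul _ (measurable_gaussianPDF 0 v) (by fun_prop)]
  -- The tilt halves the Gaussian exponent, giving the density of variance `2v`; `√2` is the ratio
  -- of the normalisers.
  have h : ∀ z : ℝ, (gaussianPDF 0 v * fun z => ENNReal.ofReal (Real.exp (z ^ 2 / (4 * v)))) z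
      = ENNReal.ofReal (Real.sqrt 2) * gaussianPDF 0 (2 * v) z := fun z => by
    rw [Pi.mul_apply, gaussianPDF, gaussianPDF, ← ENNReal.ofReal_mul (gaussianPDFReal_nonneg _ _ _),
      ← ENNReal.ofReal_mul (Real.sqrt_nonneg _)]
    congr 1
    simp only [gaussianPDFReal, NNReal.coe_mul, NNReal.coe_ofNat, sub_zero]
    have h1 : Real.sqrt (2 * Real.pi * (2 * v)) = Real.sqrt 2 * Real.sqrt (2 * Real.pi * v) := by
      rw [← Real.sqrt_mul (by norm_num)]
      congr 1
      ring
    rw [h1, mul_assoc, ← Real.exp_add, mul_inv, ← mul_assoc, ← mul_assoc,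
      mul_inv_cancel₀ (by positivity), one_mul]
    congr 2
    field_simp
    ring
  rw [lintegral_congr h, lintegral_const_mul _ (measurable_gaussianPDF _ _),
    lintegral_gaussianPDF_eq_one _ (by positivity), mul_one]

variable {X : Type u} {n m : ℕ} {M : Selection} {ε₀ : ℝ} {Dpriv : Fin n → X} {Dpub : Fin m → X}
  {Q : Finset (StatQuery X)}

lemma queryProb_nonneg (hε : 0 ≤ ε₀) {S : Finset X} (A : S → ℝ) (q : Q) :
    0 ≤ queryProb M ε₀ Dpriv Q A q :=
  selectProb_nonneg M (by positivity) _ q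

lemma sum_queryProb_eq_one (hε : 0 ≤ ε₀) (hQ : Q.Nonempty) {S : Finset X} (A : S → ℝ) :
    ∑ q : Q, ENNReal.ofReal (queryProb M ε₀ Dpriv Q A q) = 1 := by
  have : Nonempty Q := hQ.to_subtype
  rw [← ENNReal.ofReal_sum_of_nonneg fun q _ => queryProb_nonneg hε A q]
  simp only [queryProb]
  rw [sum_selectProb, ENNReal.ofReal_one]

lemma measurable_selectionGap {S : Finset X} :
    Measurable (fun p : (S → ℝ) × Q => selectionGap Dpriv p.1 p.2) := by
  have hs : ∀ r : Q, Measurable (fun A : S → ℝ => |evalDist r.1 A - evalData r.1 Dpriv|) :=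
    fun r => ((measurable_evalDist r.1).sub_const _).abs
  refine measurable_from_prod_countable_left fun q => ?_
  exact (Measurable.iSup hs).sub (hs q)

lemma measurable_transcript_prefix {T : ℕ} (t : Fin T) :
    Measurable (fun h : Transcript Q T =>
      (((fun i => h (Fin.castLE t.2.le i) : Transcript Q t), h t) : Transcript Q t × (Q × ℝ))) := by
  refine Measurable.prodMk ?_ (measurable_pi_apply t)
  rw [measurable_pi_iff]
  exact fun i => measurable_pi_apply _

variable [DecidableEq X]

lemma lintegral_roundKernel {t : ℕ} (h : Transcript Q t) {f : Q × ℝ → ENNReal} (hf : Measurable f) :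
    ∫⁻ x, f x ∂(roundKernel M ε₀ Dpriv Dpub Q t h) =
      ∑ q : Q, ENNReal.ofReal (queryProb M ε₀ Dpriv Q (iterate Dpriv Dpub Q t h) q) *
        ∫⁻ z, f (q, z) ∂(noiseLaw n ε₀) := by
  change ∫⁻ x, f x ∂(∑ q : Q, ENNReal.ofReal (queryProb M ε₀ Dpriv Q
    (iterate Dpriv Dpub Q t h) q) • ((Measure.dirac q).prod (noiseLaw n ε₀))) = _
  rw [lintegral_finsetSum_measure]
  refine Finset.sum_congr rfl fun q _ => ?_
  rw [lintegral_smul_measure, lintegral_prod _ hf.aemeasurable, smul_eq_mul,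
    lintegral_dirac' _ hf.lintegral_prod_right']

/-- If in every round the conditional expectation of a nonnegative factor is at most `K`, then the
expected product of the factors over `T` rounds is at most `K ^ T`. -/
lemma lintegral_prod_transcriptLaw_le (hε : 0 ≤ ε₀) (hQ : Q.Nonempty)
    {G : (t : ℕ) → Transcript Q t → Q × ℝ → ENNReal}
    (hG : ∀ t, Measurable (fun p : Transcript Q t × (Q × ℝ) => G t p.1 p.2)) {K : ENNReal}
    (hK : ∀ t h, ∫⁻ x, G t h x ∂(roundKernel M ε₀ Dpriv Dpub Q t h) ≤ K) (T : ℕ) :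
    ∫⁻ h, ∏ t : Fin T, G t (fun i => h (Fin.castLE t.2.le i)) (h t)
      ∂(transcriptLaw M ε₀ Dpriv Dpub Q T) ≤ K ^ T := by
  have hmeas : ∀ T : ℕ, Measurable (fun h : Transcript Q T =>
      ∏ t : Fin T, G t (fun i => h (Fin.castLE t.2.le i)) (h t)) := fun T =>
    Finset.measurable_prod _ fun t _ => (hG t).comp (measurable_transcript_prefix t)
  induction T with
  | zero => simp [transcriptLaw]
  | succ T ih =>
    have := isProbabilityMeasure_transcriptLaw M hε Dpriv Dpub hQ T
    have := isMarkovKernel_roundKernel M hε Dpriv Dpub hQ T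
    rw [transcriptLaw, lintegral_map (hmeas _) (measurable_snoc Q T)]
    refine (Measure.lintegral_compProd ((hmeas _).comp (measurable_snoc Q T))).trans_le ?_
    have hsnoc : ∀ (h : Transcript Q T) (x : Q × ℝ),
        (∏ t : Fin (T + 1), G t (fun i => (Fin.snoc (α := fun _ => Q × ℝ) h x : Transcript Q (T + 1))
            (Fin.castLE t.2.le i)) ((Fin.snoc (α := fun _ => Q × ℝ) h x : Transcript Q (T + 1)) t))
          = (∏ t : Fin T, G t (fun i => h (Fin.castLE t.2.le i)) (h t)) * G T h x := by
      intro h x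
      have hpre : ∀ (k : ℕ) (hk : k ≤ T) (hk' : k ≤ T + 1) (i : Fin k),
          (Fin.snoc (α := fun _ => Q × ℝ) h x : Transcript Q (T + 1)) (Fin.castLE hk' i)
            = h (Fin.castLE hk i) := fun k hk hk' i =>
        Fin.snoc_castSucc (α := fun _ => Q × ℝ) x h (Fin.castLE hk i)
      rw [Fin.prod_univ_castSucc]
      refine congrArg₂ _ (Finset.prod_congr rfl fun t _ => ?_) ?_
      · rw [Fin.snoc_castSucc]
        exact congrArg (fun g => G t g (h t)) (funext fun i => hpre t t.2.le _ i)
      · rw [Fin.snoc_last]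
        exact congrArg (fun g => G T g x) (funext fun i => hpre T le_rfl _ i)
    calc _ = ∫⁻ h, (∏ t : Fin T, G t (fun i => h (Fin.castLE t.2.le i)) (h t)) *
            ∫⁻ x, G T h x ∂(roundKernel M ε₀ Dpriv Dpub Q T h)
              ∂(transcriptLaw M ε₀ Dpriv Dpub Q T) := by
          refine lintegral_congr fun h => ?_
          simp only [Function.comp_apply, hsnoc]
          exact lintegral_const_mul _ ((hG T).comp measurable_prodMk_left)
      _ ≤ ∫⁻ h, (∏ t : Fin T, G t (fun i => h (Fin.castLE t.2.le i)) (h t)) * K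
              ∂(transcriptLaw M ε₀ Dpriv Dpub Q T) :=
          lintegral_mono fun h => mul_le_mul_right (hK T h) _
      _ = (∫⁻ h, (∏ t : Fin T, G t (fun i => h (Fin.castLE t.2.le i)) (h t))
              ∂(transcriptLaw M ε₀ Dpriv Dpub Q T)) * K := lintegral_mul_const _ (hmeas T)
      _ ≤ K ^ (T + 1) := by
          rw [pow_succ]
          exact mul_le_mul_left ih K

/-- A Chernoff bound for sums of adapted functions of the rounds. -/
lemma transcriptLaw_sum_ge_le (hε : 0 ≤ ε₀) (hQ : Q.Nonempty)
    {Y : (t : ℕ) → Transcript Q t → Q × ℝ → ℝ}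
    (hY : ∀ t, Measurable (fun p : Transcript Q t × (Q × ℝ) => Y t p.1 p.2)) {k : ℝ}
    (hk : ∀ t h, ∫⁻ x, ENNReal.ofReal (Real.exp (Y t h x)) ∂(roundKernel M ε₀ Dpriv Dpub Q t h)
      ≤ ENNReal.ofReal (Real.exp k)) (T : ℕ) (b : ℝ) :
    transcriptLaw M ε₀ Dpriv Dpub Q T
        {h | b ≤ ∑ t : Fin T, Y t (fun i => h (Fin.castLE t.2.le i)) (h t)}
      ≤ ENNReal.ofReal (Real.exp (T * k - b)) := by
  have h1 := lintegral_prod_transcriptLaw_le hε hQ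
    (G := fun t h x => ENNReal.ofReal (Real.exp (Y t h x))) (fun t => by
      exact (hY t).exp.ennreal_ofReal) hk T
  have hprod : ∀ h : Transcript Q T,
      ∏ t : Fin T, ENNReal.ofReal (Real.exp (Y t (fun i => h (Fin.castLE t.2.le i)) (h t)))
        = ENNReal.ofReal (Real.exp (∑ t : Fin T, Y t (fun i => h (Fin.castLE t.2.le i)) (h t))) :=
    fun h => by
      rw [Real.exp_sum, ENNReal.ofReal_prod_of_nonneg fun _ _ => (Real.exp_pos _).le]
  simp only [hprod] at h1
  have hm : Measurable fun h : Transcript Q T =>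
      ∑ t : Fin T, Y t (fun i => h (Fin.castLE t.2.le i)) (h t) :=
    Finset.measurable_sum _ fun t _ => (hY t).comp (measurable_transcript_prefix t)
  have h2 := meas_ge_le_lintegral_div (μ := transcriptLaw M ε₀ Dpriv Dpub Q T)
    (f := fun h => ENNReal.ofReal
      (Real.exp (∑ t : Fin T, Y t (fun i => h (Fin.castLE t.2.le i)) (h t))))
    hm.exp.ennreal_ofReal.aemeasurable (ε := ENNReal.ofReal (Real.exp b))
    (by simpa using Real.exp_pos b) ENNReal.ofReal_ne_top
  -- Markov's inequality for the exponential of the sum.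
  refine (measure_mono fun h hh => ENNReal.ofReal_le_ofReal (Real.exp_le_exp.2 hh)).trans
    (h2.trans ?_)
  refine (ENNReal.div_le_div_right h1 _).trans_eq ?_
  rw [← ENNReal.ofReal_pow (Real.exp_pos _).le, ← Real.exp_nat_mul,
    ← ENNReal.ofReal_div_of_pos (Real.exp_pos _), Real.exp_sub]

/-- Tail bound for the total squared noise. -/
lemma transcriptLaw_noise_tail_le (hε : 0 < ε₀) (hn : 0 < n) (hQ : Q.Nonempty) (T : ℕ) :
    transcriptLaw M ε₀ Dpriv Dpub Q T {h | T * (2 / (n ^ 2 * ε₀ ^ 2)) ≤ ∑ t, (h t).2 ^ 2}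
      ≤ ENNReal.ofReal (Real.exp (-(T / 7))) := by
  have hn' : (0 : ℝ) < n := Nat.cast_pos.2 hn
  have hvpos : (0 : ℝ) < 1 / (n ^ 2 * ε₀ ^ 2) := by positivity
  set v : NNReal := Real.toNNReal (1 / (n ^ 2 * ε₀ ^ 2)) with hv
  have hvc : (v : ℝ) = 1 / (n ^ 2 * ε₀ ^ 2) := Real.coe_toNNReal _ hvpos.le
  have hv0 : v ≠ 0 := (Real.toNNReal_pos.2 hvpos).ne'
  -- Here `exp k = √2` is the moment of one round, and noise of total square `2vT` corresponds to
  -- the threshold `T / 2`.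
  have h := transcriptLaw_sum_ge_le (M := M) (Dpriv := Dpriv) (Dpub := Dpub) hε.le hQ
    (Y := fun _ _ x => x.2 ^ 2 / (4 * v)) (fun t => by fun_prop) (k := Real.log 2 / 2)
    (fun t h => by
      rw [lintegral_roundKernel h (by fun_prop)]
      simp only [noiseLaw, ← hv, lintegral_exp_sq_gaussianReal hv0]
      rw [← Finset.sum_mul, sum_queryProb_eq_one hε.le hQ, one_mul, ← Real.log_sqrt (by norm_num),
        Real.exp_log (by positivity)]) T (T / 2)
  refine (measure_mono fun h hh => ?_).trans (h.trans (ENNReal.ofReal_le_ofReal ?_))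
  · have hh' : T * (2 / (n ^ 2 * ε₀ ^ 2)) ≤ ∑ t, (h t).2 ^ 2 := hh
    change (T / 2 : ℝ) ≤ ∑ t, (h t).2 ^ 2 / (4 * (v : ℝ))
    rw [← Finset.sum_div, le_div_iff₀ (by positivity)]
    refine hh'.trans' (le_of_eq ?_)
    rw [hvc]
    ring
  · rw [Real.exp_le_exp]
    -- The constant `7` in the condition on `T` comes from `(1 - log 2) / 2 > 1 / 7`.
    nlinarith [Real.log_two_lt_d9, (Nat.cast_nonneg T : (0 : ℝ) ≤ T)]

/-- Tail bound for the total selection gap. -/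
lemma transcriptLaw_gap_tail_le (hε : 0 < ε₀) (hn : 0 < n) (hm : 0 < m) (hQ : Q.Nonempty)
    (T : ℕ) {d : ℝ} (hd : 0 ≤ d) :
    transcriptLaw M ε₀ Dpriv Dpub Q T
        {h | T * (2 * Real.log Q.card / (n * ε₀) + d)
          ≤ ∑ t, selectionGap Dpriv (roundDist Dpriv Dpub h t) (h t).1}
      ≤ ENNReal.ofReal (Real.exp (-(2 * T * d ^ 2))) := by
  have : Nonempty Q := hQ.to_subtype
  have hn' : (0 : ℝ) < n := Nat.cast_pos.2 hn
  have hc : 0 < ε₀ * n / 2 := by positivity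
  -- For `d = 0` the right-hand side is `1`.
  rcases hd.eq_or_lt with rfl | hd
  · have := isProbabilityMeasure_transcriptLaw M hε.le Dpriv Dpub hQ T
    simpa using prob_le_one
  have hmeas : ∀ t, Measurable (fun p : Transcript Q t × (Q × ℝ) =>
      4 * d * selectionGap Dpriv (iterate Dpriv Dpub Q t p.1) p.2.1) := fun t =>
    Measurable.const_mul (measurable_selectionGap.comp
      (((measurable_iterate Dpriv Dpub Q t).comp measurable_fst).prodMk
        (measurable_fst.comp measurable_snd))) _
  -- The tilt `l = 4 d` minimises `l² / 8 - l d`, with value `-2 d²`.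
  have h := transcriptLaw_sum_ge_le (M := M) (Dpriv := Dpriv) (Dpub := Dpub) hε.le hQ
    (Y := fun t h x => 4 * d * selectionGap Dpriv (iterate Dpriv Dpub Q t h) x.1) hmeas
    (k := 4 * d * (Real.log Q.card / (ε₀ * n / 2)) + (4 * d) ^ 2 / 8)
    (fun t h => by
      have hx : Measurable fun x : Q × ℝ => ENNReal.ofReal (Real.exp
          (4 * d * selectionGap Dpriv (iterate Dpriv Dpub Q t h) x.1)) :=
        ((hmeas t).comp (measurable_prodMk_left (x := h))).exp.ennreal_ofReal
      rw [lintegral_roundKernel h hx]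
      simp only [lintegral_const, measure_univ, mul_one]
      rw [Finset.sum_congr rfl fun q _ => (ENNReal.ofReal_mul
        (queryProb_nonneg hε.le _ q)).symm]
      rw [← ENNReal.ofReal_sum_of_nonneg fun q _ =>
        mul_nonneg (queryProb_nonneg hε.le _ q) (Real.exp_pos _).le]
      refine ENNReal.ofReal_le_ofReal ?_
      have h1 := sum_selectProb_mul_exp_gap_le M hc
        (s := fun r : Q => |evalDist r.1 (iterate Dpriv Dpub Q t h) - evalData r.1 Dpriv|)
        (fun r => abs_evalDist_sub_evalData_mem_Icc r.1
          (iterate_mem_stdSimplex Dpriv Dpub Q hm t h) Dpriv) (l := 4 * d) (by positivity)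
      rw [Fintype.card_coe] at h1
      exact h1) T (4 * d * (T * (2 * Real.log Q.card / (n * ε₀) + d)))
  refine (measure_mono fun h hh => ?_).trans (h.trans_eq (congrArg _ (congrArg _ ?_)))
  · change _ ≤ ∑ t, 4 * d * selectionGap Dpriv (roundDist Dpriv Dpub h t) (h t).1
    rw [← Finset.mul_sum]
    exact mul_le_mul_of_nonneg_left hh (by positivity)
  · field_simp
    ring

end Probability

/-! ### The explicit bound. -/

/-- The explicit high-probability error bound. -/
theorem runLaw_maxError_output_le {X : Type u} [DecidableEq X] {n m : ℕ} (hn : 0 < n) (hm : 0 < m)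
    (Dpriv : Fin n → X) (Dpub : Fin m → X) {Q : Finset (StatQuery X)} (hQ : Q.Nonempty)
    {ε : ℝ} (hε : 0 < ε) {T : ℕ} (hT : 0 < T) (M : Selection) {β : ℝ} (hβ : 0 < β)
    (hβ1 : β < 1) (hTβ : 7 * Real.log (3 / β) ≤ T) :
    ENNReal.ofReal (1 - β) ≤ runLaw M ε T Dpriv Dpub Q
      {h | maxError Q Dpriv (output Dpriv Dpub Q T h) ≤
        2 * bestMixtureError Dpriv Q (supp Dpub)
        + Real.sqrt (4 * Real.log m / T + 4 * T / (ε ^ 2 * n ^ 2))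
        + 2 * Real.sqrt (2 * T) / (ε * n) * Real.log Q.card
        + Real.sqrt (1 / (2 * T) * Real.log (3 / β))} := by
  have hn' : (0 : ℝ) < n := Nat.cast_pos.2 hn
  have hT' : (0 : ℝ) < T := Nat.cast_pos.2 hT
  have hL : 0 < Real.log (3 / β) := Real.log_pos (by rw [lt_div_iff₀ hβ]; linarith)
  set ε₀ := roundEps ε T with hε₀
  have hε₀pos : 0 < ε₀ := div_pos hε (by positivity)
  have hsq : ε₀ ^ 2 = ε ^ 2 / (2 * T) := by
    rw [hε₀, roundEps, div_pow, Real.sq_sqrt (by positivity)]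
  set d := Real.sqrt (1 / (2 * T) * Real.log (3 / β))
  have hd2 : d ^ 2 = 1 / (2 * T) * Real.log (3 / β) := Real.sq_sqrt (by positivity)
  have := isProbabilityMeasure_transcriptLaw M hε₀pos.le Dpriv Dpub hQ T
  have hexp : Real.exp (-Real.log (3 / β)) = β / 3 := by
    rw [Real.exp_neg, Real.exp_log (by positivity), inv_div]
  have h1 := transcriptLaw_noise_tail_le (M := M) (Dpriv := Dpriv) (Dpub := Dpub) hε₀pos hn hQ T
  have h2 := transcriptLaw_gap_tail_le (M := M) (Dpriv := Dpriv) (Dpub := Dpub) hε₀pos hn hm hQ T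
    (Real.sqrt_nonneg (1 / (2 * T) * Real.log (3 / β)))
  replace h1 := h1.trans (ENNReal.ofReal_le_ofReal
    ((Real.exp_le_exp.2 (by linarith : -((T : ℝ) / 7) ≤ -Real.log (3 / β))).trans_eq hexp))
  replace h2 := h2.trans_eq (congrArg ENNReal.ofReal
    ((congrArg Real.exp (by rw [hd2]; field_simp : -(2 * T * d ^ 2) = -Real.log (3 / β))).trans hexp))
  set good := {h : Transcript Q T | maxError Q Dpriv (output Dpriv Dpub Q T h) ≤
        2 * bestMixtureError Dpriv Q (supp Dpub)
        + Real.sqrt (4 * Real.log m / T + 4 * T / (ε ^ 2 * n ^ 2))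
        + 2 * Real.sqrt (2 * T) / (ε * n) * Real.log Q.card + d}
  have hbad : transcriptLaw M ε₀ Dpriv Dpub Q T goodᶜ ≤ ENNReal.ofReal β := by
    have hsub : goodᶜ ⊆ {h | T * (2 / (n ^ 2 * ε₀ ^ 2)) ≤ ∑ t, (h t).2 ^ 2} ∪
        {h | T * (2 * Real.log Q.card / (n * ε₀) + d)
          ≤ ∑ t, selectionGap Dpriv (roundDist Dpriv Dpub h t) (h t).1} := by
      intro h hh
      by_contra hcon
      simp only [Set.mem_union, Set.mem_ofPred_eq, not_or, not_le] at hcon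
      refine hh ?_
      have h3 := maxError_output_le_of_good hm hQ hT h (by positivity) hcon.1.le hcon.2.le
      -- Allowing twice the noise variance as mean square gives exactly this term; no further term
      -- in `β` arises from the noise.
      have e1 : 2 / (n ^ 2 * ε₀ ^ 2) = 4 * T / (ε ^ 2 * n ^ 2) := by
        rw [hsq]
        field_simp
        ring
      have e2 : 2 * Real.log Q.card / (n * ε₀)
          = 2 * Real.sqrt (2 * T) / (ε * n) * Real.log Q.card := by
        rw [hε₀, roundEps]
        field_simp
      rw [e1, e2] at h3
      change maxError Q Dpriv (output Dpriv Dpub Q T h) ≤ _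
      linarith
    refine (measure_mono hsub).trans ((measure_union_le _ _).trans ((add_le_add h1 h2).trans ?_))
    rw [← ENNReal.ofReal_add (by positivity) (by positivity)]
    exact ENNReal.ofReal_le_ofReal (by linarith)
  have huniv := measure_univ_le_add_compl (μ := transcriptLaw M ε₀ Dpriv Dpub Q T) good
  rw [measure_univ] at huniv
  rw [ENNReal.ofReal_sub _ hβ.le, ENNReal.ofReal_one]
  exact tsub_le_iff_right.2 (huniv.trans (add_le_add le_rfl hbad))

/-! ### The asymptotic bound. -/

/-- On a dataset with a single record there is only one distribution to choose from. -/
lemma maxError_output_le_of_single {X : Type u} [DecidableEq X] {n : ℕ} (Dpriv : Fin n → X)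
    (Dpub : Fin 1 → X) {Q : Finset (StatQuery X)} {T : ℕ} (hT : 0 < T) (h : Transcript Q T) :
    maxError Q Dpriv (output Dpriv Dpub Q T h) ≤ bestMixtureError Dpriv Q (supp Dpub) := by
  have : Subsingleton (supp Dpub) := ⟨fun x y => by
    obtain ⟨i, -, hi⟩ := Finset.mem_image.1 x.2
    obtain ⟨j, -, hj⟩ := Finset.mem_image.1 y.2
    exact Subtype.ext (by rw [← hi, ← hj, Subsingleton.elim i j])⟩
  have : Nonempty (supp Dpub) := ⟨⟨Dpub 0, Finset.mem_image_of_mem _ (Finset.mem_univ _)⟩⟩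
  have : Nonempty (stdSimplex ℝ (supp Dpub)) := ⟨_, empirical_mem_stdSimplex one_pos Dpub⟩
  have huniq : ∀ A ∈ stdSimplex ℝ (supp Dpub), A = fun _ => 1 := fun A hA => by
    simpa [stdSimplex_unique] using hA
  refine le_ciInf fun μ => ?_
  rw [huniq _ (output_mem_stdSimplex one_pos hT h), huniq (μ : supp Dpub → ℝ) μ.2]

/-- The estimates that turn the explicit bound into the asymptotic one: `N` is `n ε`, `s` is
`√(log m)`, `K` is `log |Q|`, `L` is `log (1 / β)`. -/
lemma explicit_bound_le {c₁ c₂ N s K L T C : ℝ} (hc₁ : 0 < c₁) (hc₂ : 0 < c₂) (hN : 0 < N)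
    (hs : 0.83 ≤ s) (hK : 0.69 ≤ K) (hL : 0 ≤ L) (hC2 : 2 ≤ C) (hC : 20 / c₁ ≤ C)
    (hsmall : C * Real.sqrt (K * (s + L) / N) < 1) (hT1 : c₁ * (N * s / K + L) ≤ T)
    (hT2 : T ≤ c₂ * (N * s / K + L) + 1) {L₃ : ℝ} (hL₃ : L₃ ≤ 1.39 + L) :
    7 * L₃ ≤ T ∧
      Real.sqrt (4 * s ^ 2 / T + 4 * T / N ^ 2) + 2 * Real.sqrt (2 * T) / N * K
        + Real.sqrt (1 / (2 * T) * L₃) ≤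
      (Real.sqrt (4 / c₁ + 18 * (c₂ + 1)) + 2 * Real.sqrt (4 * (c₂ + 1)) + Real.sqrt (2 / c₁)) *
        Real.sqrt (K * (s + L) / N) := by
  have hs0 : 0 < s := by linarith
  have hK0 : 0 < K := by linarith
  set V := s + L with hV
  have hV0 : 0 < V := by linarith
  set W := K * V / N with hW
  have hW0 : 0 < W := by positivity
  set y := N * s / K with hy
  have hy0 : 0 < y := by positivity
  have hyW : s * V = y * W := by rw [hy, hW]; field_simp
  have hCW : C ^ 2 * W ≤ 1 := by
    have h1 : (C * Real.sqrt W) ^ 2 ≤ 1 := pow_le_one₀ (by positivity) hsmall.le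
    rwa [mul_pow, Real.sq_sqrt hW0.le] at h1
  -- Smallness of the target bound says `C² W ≤ 1`; since `s V = y W`, this forces `y` to dominate
  -- `s V`, and so `L`.
  have hyC : C ^ 2 * (s * V) ≤ y := by
    rw [hyW]
    nlinarith
  have hsV : 0.68 + 0.83 * L ≤ s * V := by
    rw [hV]
    nlinarith
  have hc₁C : 20 ≤ c₁ * C := by
    rw [div_le_iff₀ hc₁] at hC
    linarith
  have hCC : C ≤ C ^ 2 := by nlinarith
  have hy1 : 2 * (0.68 + 0.83 * L) ≤ y :=
    (mul_le_mul (hC2.trans hCC) hsV (by positivity) (by positivity)).trans hyC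
  have hTy : c₁ * y ≤ T := by nlinarith
  have hT0 : 0 < T := (mul_pos hc₁ hy0).trans_le hTy
  -- By `hy1` both `L` and the rounding term `1` are at most `y`.
  have hTb : T ≤ 2 * (c₂ + 1) * y := by nlinarith
  refine ⟨?_, ?_⟩
  · have h1 : 20 * (0.68 + 0.83 * L) ≤ c₁ * y :=
      calc _ ≤ c₁ * C * (s * V) := mul_le_mul hc₁C hsV (by positivity) (by positivity)
        _ ≤ c₁ * C ^ 2 * (s * V) := by gcongr
        _ = c₁ * (C ^ 2 * (s * V)) := by ring
        _ ≤ _ := by gcongr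
    linarith
  · have e1 : 4 * s ^ 2 / T ≤ 4 / c₁ * W := by
      calc 4 * s ^ 2 / T ≤ 4 * s ^ 2 / (c₁ * y) := by gcongr
        _ ≤ 4 * (s * V) / (c₁ * y) := by
            gcongr
            rw [sq]
            gcongr
            linarith
        _ = _ := by rw [hyW]; field_simp
    have e2 : 4 * T / N ^ 2 ≤ 18 * (c₂ + 1) * W := by
      calc 4 * T / N ^ 2 ≤ 4 * (2 * (c₂ + 1) * y) / N ^ 2 := by gcongr
        _ = 2 * (c₂ + 1) / N * (4 / K * s) := by rw [hy]; field_simp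
        -- Uses `4 / K ≤ 9 K`, as `9 * 0.69 ^ 2 > 4`.
        _ ≤ 2 * (c₂ + 1) / N * (9 * K * V) := by
            gcongr
            · rw [div_le_iff₀ hK0]
              nlinarith
            · linarith
        _ = _ := by rw [hW]; ring
    have e3 : Real.sqrt (2 * T) / N * K ≤ Real.sqrt (4 * (c₂ + 1)) * Real.sqrt W := by
      rw [← Real.sqrt_mul (by positivity)]
      refine Real.le_sqrt_of_sq_le ?_
      rw [mul_pow, div_pow, Real.sq_sqrt (by positivity)]
      calc 2 * T / N ^ 2 * K ^ 2 ≤ 2 * (2 * (c₂ + 1) * y) / N ^ 2 * K ^ 2 := by gcongr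
        _ = 4 * (c₂ + 1) * (K * s / N) := by rw [hy]; field_simp; ring
        _ ≤ _ := by
            rw [hW]
            gcongr
            linarith
    have e4 : 1 / (2 * T) * L₃ ≤ 2 / c₁ * W := by
      have h1 : L₃ ≤ 2 * V := by linarith
      calc 1 / (2 * T) * L₃ ≤ 1 / (2 * T) * (2 * V) := by gcongr
        _ = V / T := by field_simp
        _ ≤ V / (c₁ * y) := by gcongr
        _ ≤ 2 * (s * V) / (c₁ * y) := by
            gcongr
            nlinarith
        _ = _ := by rw [hyW]; field_simp
    have f1 : Real.sqrt (4 * s ^ 2 / T + 4 * T / N ^ 2) ≤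
        Real.sqrt (4 / c₁ + 18 * (c₂ + 1)) * Real.sqrt W := by
      rw [← Real.sqrt_mul (by positivity)]
      exact Real.sqrt_le_sqrt (by linarith)
    have f4 : Real.sqrt (1 / (2 * T) * L₃) ≤ Real.sqrt (2 / c₁) * Real.sqrt W := by
      rw [← Real.sqrt_mul (by positivity)]
      exact Real.sqrt_le_sqrt e4
    have e3' : 2 * Real.sqrt (2 * T) / N * K = 2 * (Real.sqrt (2 * T) / N * K) := by ring
    rw [e3']
    linarith

/-- The error bound when the number of rounds is of the order that balances its terms. -/
theorem exists_runLaw_maxError_output_le {c₁ c₂ : ℝ} (hc₁ : 0 < c₁) (hc₂ : 0 < c₂) :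
    ∃ C : ℝ, 0 < C ∧
      ∀ (X : Type u) [DecidableEq X] (n m : ℕ) (_ : 0 < n) (_ : 0 < m)
        (Dpriv : Fin n → X) (Dpub : Fin m → X) (Q : Finset (StatQuery X)) (_ : 2 ≤ Q.card)
        (ε : ℝ) (_ : 0 < ε) (β : ℝ) (_ : 0 < β) (_ : β < 1) (T : ℕ) (_ : 0 < T)
        (M : Selection),
        c₁ * (n * ε * Real.sqrt (Real.log m) / Real.log Q.card + Real.log (1 / β)) ≤ T →
        T ≤ c₂ * (n * ε * Real.sqrt (Real.log m) / Real.log Q.card + Real.log (1 / β)) + 1 →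
        ENNReal.ofReal (1 - β) ≤ runLaw M ε T Dpriv Dpub Q
          {h | maxError Q Dpriv (output Dpriv Dpub Q T h) ≤
            C * (Real.sqrt (Real.log Q.card * (Real.sqrt (Real.log m) + Real.log (1 / β))
                  / (n * ε))
              + bestMixtureError Dpriv Q (supp Dpub))} := by
  set C₀ := Real.sqrt (4 / c₁ + 18 * (c₂ + 1)) + 2 * Real.sqrt (4 * (c₂ + 1)) + Real.sqrt (2 / c₁)
    with hC₀
  have hC₀pos : 0 ≤ C₀ := by positivity
  have h20 : 0 < 20 / c₁ := by positivity
  -- `C₀` covers the three error terms, `2` the factor of the mixture error, and `20 / c₁` forces `7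
  -- log (3 / β) ≤ T` in the nontrivial case.
  refine ⟨C₀ + 2 + 20 / c₁, by positivity, ?_⟩
  intro X _ n m hn hm Dpriv Dpub Q hQ ε hε β hβ hβ1 T hT M hT1 hT2
  set C := C₀ + 2 + 20 / c₁ with hC
  have hQne : Q.Nonempty := Finset.card_pos.1 (by omega)
  have hn' : (0 : ℝ) < n := Nat.cast_pos.2 hn
  have hT' : (0 : ℝ) < T := Nat.cast_pos.2 hT
  have hf := bestMixtureError_nonneg Dpriv Q (supp Dpub)
  have hprob : IsProbabilityMeasure (runLaw M ε T Dpriv Dpub Q) :=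
    isProbabilityMeasure_transcriptLaw M (div_nonneg hε.le (Real.sqrt_nonneg _)) Dpriv Dpub hQne T
  set U := Real.sqrt (Real.log Q.card * (Real.sqrt (Real.log m) + Real.log (1 / β)) / (n * ε))
    with hU
  have hU0 : 0 ≤ U := Real.sqrt_nonneg _
  have htriv : (∀ h : Transcript Q T, maxError Q Dpriv (output Dpriv Dpub Q T h) ≤
      C * (U + bestMixtureError Dpriv Q (supp Dpub))) →
      ENNReal.ofReal (1 - β) ≤ runLaw M ε T Dpriv Dpub Q
        {h | maxError Q Dpriv (output Dpriv Dpub Q T h) ≤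
          C * (U + bestMixtureError Dpriv Q (supp Dpub))} := fun h => by
    rw [Set.eq_univ_of_forall (s := {h | maxError Q Dpriv (output Dpriv Dpub Q T h) ≤
      C * (U + bestMixtureError Dpriv Q (supp Dpub))}) h, measure_univ, ENNReal.ofReal_le_one]
    linarith
  -- At `m = 1`, `log m` vanishes and gives no lower bound on `s`, so this case is settled directly.
  rcases (Nat.one_le_iff_ne_zero.2 hm.ne').eq_or_lt with rfl | hm2
  · refine htriv fun h => (maxError_output_le_of_single Dpriv Dpub hT h).trans ?_
    nlinarith
  -- Errors never exceed `1`, so a large target bound holds for every transcript.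
  rcases le_or_gt 1 (C * U) with hCU | hCU
  · refine htriv fun h => (maxError_le_one hQne Dpriv (output_mem_stdSimplex hm hT h)).trans ?_
    nlinarith
  have hlog2 := Real.log_two_gt_d9
  have hlogm : 0.83 ≤ Real.sqrt (Real.log m) := by
    refine Real.le_sqrt_of_sq_le ?_
    have h1 : Real.log 2 ≤ Real.log m := Real.log_le_log (by norm_num) (by exact_mod_cast hm2)
    norm_num at hlog2 ⊢
    linarith
  have hlogQ : 0.69 ≤ Real.log Q.card := by
    have h1 : Real.log 2 ≤ Real.log Q.card := Real.log_le_log (by norm_num) (by exact_mod_cast hQ)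
    norm_num at hlog2 ⊢
    linarith
  have hlogβ : 0 ≤ Real.log (1 / β) := Real.log_nonneg (by rw [le_div_iff₀ hβ]; linarith)
  have hlog3 : Real.log (3 / β) ≤ 1.39 + Real.log (1 / β) := by
    have h1 : Real.log 3 ≤ 2 * Real.log 2 := by
      rw [← Real.log_rpow (by norm_num)]
      exact Real.log_le_log (by norm_num) (by norm_num)
    have h2 := Real.log_two_lt_d9
    rw [← mul_one_div, Real.log_mul (by norm_num) (by positivity)]
    norm_num at h2 ⊢
    linarith
  obtain ⟨h7, hle⟩ := explicit_bound_le hc₁ hc₂ (by positivity : 0 < n * ε) hlogm hlogQ hlogβ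
    (by linarith : 2 ≤ C) (by linarith) hCU hT1 hT2 hlog3
  refine (runLaw_maxError_output_le hn hm Dpriv Dpub hQne hε hT M hβ hβ1 h7).trans
    (measure_mono fun h hh => ?_)
  change _ ≤ C * (U + bestMixtureError Dpriv Q (supp Dpub))
  refine le_trans hh ?_
  rw [Real.sq_sqrt (Real.log_natCast_nonneg m), ← hC₀] at hle
  rw [← mul_pow, mul_comm ε]
  have h1 : C₀ * U ≤ C * U := mul_le_mul_of_nonneg_right (by linarith) hU0
  have h2 : 2 * bestMixtureError Dpriv Q (supp Dpub) ≤ C * bestMixtureError Dpriv Q (supp Dpub) :=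
    mul_le_mul_of_nonneg_right (by linarith) hf
  linarith

end PMWPub

theorem mainTheorem1 :
    (∀ (X : Type u) [DecidableEq X] (n m : ℕ) (_ : 0 < n) (_ : 0 < m)
      (Dpriv : Fin n → X) (Dpub : Fin m → X) (Q : Finset (StatQuery X)) (_ : Q.Nonempty)
      (ε : ℝ) (_ : 0 < ε) (T : ℕ) (_ : 0 < T) (M : Selection),
      (∀ h : Transcript Q T, output Dpriv Dpub Q T h ∈ stdSimplex ℝ (supp Dpub)) ∧
      ∀ β : ℝ, 0 < β → β < 1 → 7 * Real.log (3 / β) ≤ T →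
        ENNReal.ofReal (1 - β) ≤ runLaw M ε T Dpriv Dpub Q
          {h | maxError Q Dpriv (output Dpriv Dpub Q T h) ≤
            2 * bestMixtureError Dpriv Q (supp Dpub)
            + Real.sqrt (4 * Real.log m / T + 4 * T / (ε ^ 2 * n ^ 2)
                + 4 * Real.sqrt (Real.log (3 / β)) / (ε * n))
            + 2 * Real.sqrt (2 * T) / (ε * n) * Real.log Q.card
            + Real.sqrt (1 / (2 * T) * Real.log (3 / β))}) ∧
    (∀ c₁ c₂ : ℝ, 0 < c₁ → 0 < c₂ → ∃ C : ℝ, 0 < C ∧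
      ∀ (X : Type u) [DecidableEq X] (n m : ℕ) (_ : 0 < n) (_ : 0 < m)
        (Dpriv : Fin n → X) (Dpub : Fin m → X) (Q : Finset (StatQuery X)) (_ : 2 ≤ Q.card)
        (ε : ℝ) (_ : 0 < ε) (β : ℝ) (_ : 0 < β) (_ : β < 1) (T : ℕ) (_ : 0 < T)
        (M : Selection),
        c₁ * (n * ε * Real.sqrt (Real.log m) / Real.log Q.card + Real.log (1 / β)) ≤ T →
        T ≤ c₂ * (n * ε * Real.sqrt (Real.log m) / Real.log Q.card + Real.log (1 / β)) + 1 →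
        ENNReal.ofReal (1 - β) ≤ runLaw M ε T Dpriv Dpub Q
          {h | maxError Q Dpriv (output Dpriv Dpub Q T h) ≤
            C * (Real.sqrt (Real.log Q.card * (Real.sqrt (Real.log m) + Real.log (1 / β))
                  / (n * ε))
              + bestMixtureError Dpriv Q (supp Dpub))}) := by
  refine ⟨fun X _ n m hn hm Dpriv Dpub Q hQ ε hε T hT M => ⟨output_mem_stdSimplex hm hT,
    fun β hβ hβ1 hTβ => ?_⟩, fun c₁ c₂ hc₁ hc₂ => exists_runLaw_maxError_output_le hc₁ hc₂⟩
  refine (runLaw_maxError_output_le hn hm Dpriv Dpub hQ hε hT M hβ hβ1 hTβ).trans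
    (measure_mono (Set.ofPred_subset_ofPred.2 fun h hh => hh.trans ?_))
  -- The sharper bound already proved lacks this nonnegative term under the square root.
  have hextra : 0 ≤ 4 * Real.sqrt (Real.log (3 / β)) / (ε * n) := by positivity
  have hsqrt := Real.sqrt_le_sqrt (le_add_of_nonneg_right hextra :
    4 * Real.log m / T + 4 * T / (ε ^ 2 * n ^ 2) ≤ _)
  linarith
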